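/- Let $X$ be a (nonempty) compact geodesic metric space, i.e. any two points $x,y\in X$ are joined by a curve isometric to the interval $[0,d(x,y)]$. Definitions. A closed geodesic of length $L>0$ is a map from the circle of circumference $L$ (with its arc metric) to $X$ whose restriction to every sufficiently small arc is an isometry onto its image. The $1$-systole $\sigma_1\in[0,\infty]$ of $X$ is the infimum of the lengths of the closed geodesics in $X$ that are not null-homotopic ($\sigma_1=\infty$ if there are none). For $\varepsilon>0$, an $\varepsilon$-chain is a finite sequence $\{x_0,\dots,x_n\}$ in $X$ with $d(x_i,x_{i+1})<\varepsilon$ for all $i$; it is an $\varepsilon$-loop if $x_n=x_0$. Two $\varepsilon$-chains with the same endpoints are $\varepsilon$-homotopic if one can be transformed into the other by finitely many steps, each of which adds or removes a single point, such that all intermediate sequences are $\varepsilon$-chains with the same endpoints. An $\varepsilon$-loop $\{x_0,\dots,x_n=x_0\}$ is $\varepsilon$-null if it is $\varepsilon$-homotopic to $\{x_0\}$, and $\varepsilon$-critical if it is not $\varepsilon$-null but is $\delta$-null for all $\delta>\varepsilon$. The number $\varepsilon>0$ is a homotopy critical value of $X$ if an $\varepsilon$-critical $\varepsilon$-loop exists;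 the homotopy critical spectrum is the set of all homotopy critical values. The space $X$ is semilocally simply connected if every point has an open neighbourhood $U$ such that every loop in $U$ is null-homotopic in $X$. Corollary. (1) $\sigma_1/3$ is a lower bound for the homotopy critical spectrum of $X$, that is, $\sigma_1/3\le\varepsilon$ for every homotopy critical value $\varepsilon$ (in particular there are none if $\sigma_1=\infty$). (2) If $X$ is semilocally simply connected and not simply connected, then $0<\sigma_1<\infty$ and $\sigma_1/3$ is the smallest homotopy critical value of $X$ (in particular it is a homotopy critical value). -/

import Mathlib

open Set Topology
open scoped ENNReal

noncomputable section

namespace DiscreteHomotopy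

/-- A metric space is geodesic if any two points are joined by an arclength parameterized
curve whose length is the distance of its endpoints, i.e. by an isometric embedding of the interval
`[0, dist x y]`. -/
def IsGeodesicSpace (X : Type*) [MetricSpace X] : Prop :=
  ∀ x y : X, ∃ γ : ℝ → X, γ 0 = x ∧ γ (dist x y) = y ∧
    ∀ s ∈ Icc (0 : ℝ) (dist x y), ∀ t ∈ Icc (0 : ℝ) (dist x y), dist (γ s) (γ t) = |s - t|

/-- Every point has an open neighbourhood `U` such that every loop in `U` is null-homotopic
in the whole space. -/
def SemilocallySimplyConnected (X : Type*) [TopologicalSpace X] : Prop :=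
  ∀ x : X, ∃ U : Set X, IsOpen U ∧ x ∈ U ∧
    ∀ (y : X) (γ : Path y y), range γ ⊆ U → γ.Homotopic (Path.refl y)

section Chains

variable {X : Type*} [MetricSpace X]

/-- An `ε`-chain: a finite (nonempty) sequence of points whose consecutive members have
distance `< ε`. -/
def IsEpsChain (ε : ℝ) (α : List X) : Prop :=
  α ≠ [] ∧ α.IsChain (fun x y => dist x y < ε)

/-- `β` arises from `α` by inserting a single point somewhere. -/
def InsertsPoint (α β : List X) : Prop :=
  ∃ (l₁ l₂ : List X) (x : X), α = l₁ ++ l₂ ∧ β = l₁ ++ x :: l₂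

/-- A basic move between two `ε`-chains with the same endpoints: adding or removing a single
point. -/
def BasicMove (ε : ℝ) (α β : List X) : Prop :=
  IsEpsChain ε α ∧ IsEpsChain ε β ∧ α.head? = β.head? ∧ α.getLast? = β.getLast? ∧
    (InsertsPoint α β ∨ InsertsPoint β α)

/-- `ε`-homotopy: a finite sequence of basic moves through `ε`-chains, all of them with the same
endpoints. -/
def EpsHomotopic (ε : ℝ) (α β : List X) : Prop :=
  IsEpsChain ε α ∧ IsEpsChain ε β ∧ Relation.ReflTransGen (BasicMove ε) α β

/-- An `ε`-loop based at `x`: an `ε`-chain that starts and ends at `x`. -/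
def IsEpsLoop (ε : ℝ) (x : X) (α : List X) : Prop :=
  IsEpsChain ε α ∧ α.head? = some x ∧ α.getLast? = some x

/-- A loop based at `x` is `ε`-null if it is `ε`-homotopic to the trivial loop `{x}`. -/
def IsEpsNull (ε : ℝ) (x : X) (α : List X) : Prop :=
  EpsHomotopic ε α [x]

/-- An `ε`-loop is `ε`-critical if it is not `ε`-null, but is `δ`-null for all `δ > ε`. -/
def IsEpsCritical (ε : ℝ) (x : X) (α : List X) : Prop :=
  IsEpsLoop ε x α ∧ ¬ IsEpsNull ε x α ∧ ∀ δ : ℝ, ε < δ → IsEpsNull δ x α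

variable (X) in
/-- The set of homotopy critical values: all `ε > 0` for which an `ε`-critical `ε`-loop exists. -/
def homotopyCriticalSpectrum : Set ℝ :=
  {ε | 0 < ε ∧ ∃ (x : X) (α : List X), IsEpsCritical ε x α}

end Chains

section Systole

variable {X : Type*} [MetricSpace X]

/-- A closed geodesic of length `L > 0`: a map from the circle of circumference `L` (with its arc
metric, which is the metric of `AddCircle L`) whose restriction to every sufficiently small arc is
distance preserving. -/
def IsClosedGeodesic (L : ℝ) (c : C(AddCircle L, X)) : Prop :=
  0 < L ∧ ∃ r : ℝ, 0 < r ∧ ∀ s t : AddCircle L, dist s t < r → dist (c s) (c t) = dist s t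

variable (X) in
/-- The lengths of the closed geodesics that are not null-homotopic. -/
def nonNullGeodesicLengths : Set ℝ :=
  {L | ∃ c : C(AddCircle L, X), IsClosedGeodesic L c ∧ ¬ c.Nullhomotopic}

variable (X) in
/-- The `1`-systole: the infimum of the lengths of the closed geodesics that are not
null-homotopic, taken in `[0, ∞]` (so it is `∞` if there are none). -/
def oneSystole : ℝ≥0∞ :=
  ⨅ L ∈ nonNullGeodesicLengths X, ENNReal.ofReal L

end Systole

end DiscreteHomotopy

end

-- Both parts rest on integrating a group-valued local cocycle `e`, multiplicative on triangles with
-- sides `< r`, along curves. The resulting `increment` is trivial on null-homotopic circles. By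
-- compactness, among rectifiable loops with nontrivial increment there is a shortest one
-- (`exists_shortest_loop`). It is an isometric circle: a chord shorter than both arcs would split
-- it into two shorter loops, whose increments are trivial (`le_dist_of_shortest`). If all loops of
-- length `< 3δ` have trivial increment, then integrating `e` along geodesics gives a cocycle at
-- scale `δ`, because a geodesic triangle with sides `< δ` is such a loop; this is the source of the
-- factor `3`.
--
-- For (1), take for `e` the action of points on `ε`-homotopy classes of chains, whose products
-- detect `ε`-null loops. If loops of length `< 3δ` were trivial, a `δ`-null `ε`-loop would have
-- product `1` and be `ε`-null. So an `ε`-critical loop yields, for every `δ > ε`, a non-null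
-- isometric circle shorter than `3δ`.
--
-- For (2), take for `e` the homotopy classes of short geodesics. Now trivial increment means
-- null-homotopic, so the shortest circle has length `L = σ₁`, and six equidistant points on it form
-- an `L/3`-critical loop.

universe u

namespace DiscreteHomotopy

/-! ### Local cocycles and their primitives along curves -/

section Cocycle

variable {X G : Type*} [Group G] {r : ℝ} {e : X → X → G} {f : ℝ → X} {A : ℝ → G}

/-- A primitive of the cocycle `e` along the curve `f`. -/
def IsPrimitive (e : X → X → G) (f : ℝ → X) (A : ℝ → G) : Prop :=
  ∃ η > 0, ∀ s t, |s - t| ≤ η → A s * e (f s) (f t) = A t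

/-- Connectedness of `ℝ` replaces subdividing an interval. The target may be `Prop`, which is how
homotopy invariance is proved. -/
theorem eq_of_locally_eq {α : Type*} {φ : ℝ → α} (h : ∃ η > 0, ∀ s t, |s - t| ≤ η → φ s = φ t)
    (s t : ℝ) : φ s = φ t := by
  obtain ⟨η, hη, h⟩ := h
  have : IsLocallyConstant φ := by
    rw [IsLocallyConstant.iff_eventually_eq]
    intro x
    filter_upwards [Metric.ball_mem_nhds x hη] with y hy
    exact h _ _ (by rw [← Real.dist_eq]; exact (Metric.mem_ball.1 hy).le)
  exact this.apply_eq_of_preconnectedSpace s t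

theorem exists_int_primitive (g : ℤ → G) : ∃ a : ℤ → G, ∀ k, a k * g k = a (k + 1) := by
  let p : ℕ → G := fun n => Nat.rec 1 (fun n q => q * g n) n
  let q : ℕ → G := fun n => Nat.rec 1 (fun n q => q * (g (-(n + 1 : ℤ)))⁻¹) n
  refine ⟨fun k => if 0 ≤ k then p k.toNat else q (-k).toNat, fun k => ?_⟩
  rcases lt_trichotomy k (-1) with hk | rfl | hk
  · obtain ⟨n, rfl⟩ : ∃ n : ℕ, k = -(n + 2 : ℤ) := ⟨(-k - 2).toNat, by omega⟩
    have h1 : ¬ (0 : ℤ) ≤ -(n + 2 : ℤ) := by omega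
    have h2 : ¬ (0 : ℤ) ≤ -(n + 2 : ℤ) + 1 := by omega
    have h3 : (-(-(n + 2 : ℤ))).toNat = n + 1 + 1 := by omega
    have h4 : (-(-(n + 2 : ℤ) + 1)).toNat = n + 1 := by omega
    simp only [h1, h2, h3, h4, if_false]
    change q (n + 1) * (g (-(((n + 1 : ℕ) : ℤ) + 1)))⁻¹ * _ = q (n + 1)
    have : (-(((n + 1 : ℕ) : ℤ) + 1)) = -(n + 2 : ℤ) := by push_cast; ring
    rw [this, inv_mul_cancel_right]
  · simp [p, q]
  · obtain ⟨n, rfl⟩ : ∃ n : ℕ, k = n := ⟨k.toNat, by omega⟩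
    have h1 : (0 : ℤ) ≤ (n : ℤ) + 1 := by omega
    have h3 : ((n : ℤ) + 1).toNat = n + 1 := by omega
    simp [h1, h3, p]

theorem IsPrimitive.comp (hA : IsPrimitive e f A) {K : NNReal} {φ : ℝ → ℝ}
    (hφ : LipschitzWith K φ) : IsPrimitive e (f ∘ φ) (A ∘ φ) := by
  obtain ⟨η, hη, h⟩ := hA
  refine ⟨η / (K + 1), by positivity, fun s t hst => h _ _ ?_⟩
  have h1 := hφ.dist_le_mul s t
  rw [Real.dist_eq, Real.dist_eq] at h1
  rw [le_div_iff₀ (by positivity)] at hst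
  nlinarith [abs_nonneg (s - t)]

theorem lipschitzWith_clamp (a b : ℝ) : LipschitzWith 1 fun t => max a (min b t) := by
  simpa using ((LipschitzWith.id (α := ℝ)).const_min b).const_max a

/-- Both primitives change by the same right factor, so `A * A'⁻¹` is locally constant. Clamping
time to `[a, b]` makes the two curves agree on all of `ℝ`. -/
theorem IsPrimitive.div_eq {f' : ℝ → X} {A' : ℝ → G} (hA : IsPrimitive e f A)
    (hA' : IsPrimitive e f' A') {a b : ℝ} (hab : a ≤ b) (hff' : ∀ t ∈ Icc a b, f t = f' t) :
    (A a)⁻¹ * A b = (A' a)⁻¹ * A' b := by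
  obtain ⟨η, hη, h⟩ := hA.comp (lipschitzWith_clamp a b)
  obtain ⟨η', hη', h'⟩ := hA'.comp (lipschitzWith_clamp a b)
  have heq : ∀ t, f (max a (min b t)) = f' (max a (min b t)) := fun t =>
    hff' _ ⟨le_max_left _ _, max_le hab (min_le_left _ _)⟩
  have := eq_of_locally_eq (φ := fun t => A (max a (min b t)) * (A' (max a (min b t)))⁻¹)
    ⟨min η η', by positivity, fun s t hst => by
      have h1 := h s t (hst.trans (min_le_left _ _))
      have h2 := h' s t (hst.trans (min_le_right _ _))
      simp only [Function.comp_apply] at h1 h2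
      rw [← h1, ← h2, heq, heq]
      group⟩ a b
  simp only [min_eq_right hab, max_self, min_self, max_eq_right hab] at this
  rw [mul_inv_eq_iff_eq_mul] at this
  rw [this]
  group

open Classical in
/-- The increment over `[a, b]` of a primitive of `e` along `f`. -/
noncomputable def increment (e : X → X → G) (f : ℝ → X) (a b : ℝ) : G :=
  -- The default `1` never matters for a local cocycle with `r > 0` and a uniformly continuous
  -- curve: a primitive then exists.
  if h : ∃ A, IsPrimitive e f A then (h.choose a)⁻¹ * h.choose b else 1

theorem IsPrimitive.increment_eq (hA : IsPrimitive e f A) (a b : ℝ) :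
    increment e f a b = (A a)⁻¹ * A b := by
  have h : ∃ A, IsPrimitive e f A := ⟨A, hA⟩
  rw [increment, dif_pos h]
  rcases le_total a b with hab | hab
  · exact h.choose_spec.div_eq hA hab fun _ _ => rfl
  · have := h.choose_spec.div_eq hA hab fun _ _ => rfl
    rw [← inv_inj]
    simpa using this

theorem increment_self (a : ℝ) : increment e f a a = 1 := by
  unfold increment
  split_ifs <;> simp

theorem increment_symm (a b : ℝ) : increment e f a b = (increment e f b a)⁻¹ := by
  unfold increment
  split_ifs <;> simp

variable [MetricSpace X]

/-- A group-valued function of two points that is multiplicative on triangles with sides `< r`. -/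
def IsLocalCocycle (r : ℝ) (e : X → X → G) : Prop :=
  ∀ x y z, dist x y < r → dist y z < r → dist x z < r → e x y * e y z = e x z

theorem IsLocalCocycle.self (he : IsLocalCocycle r e) (hr : 0 < r) (x : X) : e x x = 1 := by
  have := he x x x (by simpa) (by simpa) (by simpa)
  simpa using this

theorem IsLocalCocycle.mul_swap (he : IsLocalCocycle r e) (hr : 0 < r) {x y : X}
    (h : dist x y < r) : e x y * e y x = 1 := by
  rw [he x y x h (by rwa [dist_comm]) (by simpa), he.self hr]

theorem IsLocalCocycle.exists_isPrimitive (he : IsLocalCocycle r e) (hr : 0 < r)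
    (hf : UniformContinuous f) : ∃ A, IsPrimitive e f A := by
  obtain ⟨η', hη', hd⟩ := Metric.uniformContinuous_iff.1 hf r hr
  -- Times at most `η` apart lie in the same or adjacent cells of the grid `ηℤ`, so all points
  -- compared below are within `2 * η` in time.
  obtain ⟨η, hη, hlt⟩ : ∃ η > 0, 2 * η < η' := ⟨η' / 3, by positivity, by linarith⟩
  have hd' : ∀ s t, |s - t| ≤ 2 * η → dist (f s) (f t) < r := fun s t h =>
    hd (by rw [Real.dist_eq]; linarith)
  obtain ⟨a, ha⟩ := exists_int_primitive fun k : ℤ => e (f (k * η)) (f ((k + 1 : ℤ) * η))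
  have key : ∀ s t, s ≤ t → t - s ≤ η →
      a ⌊s / η⌋ * e (f (⌊s / η⌋ * η)) (f s) * e (f s) (f t) =
      a ⌊t / η⌋ * e (f (⌊t / η⌋ * η)) (f t) := by
    intro s t hst hst'
    have h1 := (le_div_iff₀ hη).1 (Int.floor_le (s / η))
    have h2 := (div_lt_iff₀ hη).1 (Int.lt_floor_add_one (s / η))
    have h3 := (le_div_iff₀ hη).1 (Int.floor_le (t / η))
    have h4 := (div_lt_iff₀ hη).1 (Int.lt_floor_add_one (t / η))
    have h5 : ⌊s / η⌋ ≤ ⌊t / η⌋ := Int.floor_le_floor (by gcongr)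
    have h6 : ⌊t / η⌋ ≤ ⌊s / η⌋ + 1 := by
      rw [← Int.floor_add_one]
      apply Int.floor_le_floor
      rw [div_add_one hη.ne']
      gcongr
      linarith
    rw [mul_assoc, he _ _ _ (hd' _ _ (by rw [abs_le]; constructor <;> nlinarith))
      (hd' _ _ (by rw [abs_le]; constructor <;> nlinarith))
      (hd' _ _ (by rw [abs_le]; constructor <;> nlinarith))]
    obtain h | h : ⌊t / η⌋ = ⌊s / η⌋ ∨ ⌊t / η⌋ = ⌊s / η⌋ + 1 := by omega
    · rw [h]
    · rw [h] at h3 h4 ⊢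
      push_cast at h3 h4
      rw [← ha, mul_assoc, he]
      all_goals
        apply hd'
        push_cast
        rw [abs_le]
        constructor <;> nlinarith
  refine ⟨fun t => a ⌊t / η⌋ * e (f (⌊t / η⌋ * η)) (f t), η, hη, fun s t hst => ?_⟩
  rcases le_total s t with h | h
  · exact key s t h (by rw [abs_le] at hst; linarith)
  · have := key t s h (by rw [abs_le] at hst; linarith)
    have hlt : dist (f t) (f s) < r := hd' _ _ (by rw [abs_sub_comm]; linarith)
    simp only
    rw [← this, mul_assoc, he.mul_swap hr hlt, mul_one]

theorem increment_mul (he : IsLocalCocycle r e) (hr : 0 < r) (hf : UniformContinuous f)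
    (a b c : ℝ) : increment e f a b * increment e f b c = increment e f a c := by
  obtain ⟨A, hA⟩ := he.exists_isPrimitive hr hf
  simp only [hA.increment_eq]
  group

theorem increment_congr (he : IsLocalCocycle r e) (hr : 0 < r) (hf : UniformContinuous f)
    {f' : ℝ → X} (hf' : UniformContinuous f') {a b : ℝ} (hab : a ≤ b)
    (h : ∀ t ∈ Icc a b, f t = f' t) : increment e f a b = increment e f' a b := by
  obtain ⟨A, hA⟩ := he.exists_isPrimitive hr hf
  obtain ⟨A', hA'⟩ := he.exists_isPrimitive hr hf'
  rw [hA.increment_eq, hA'.increment_eq, hA.div_eq hA' hab h]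

theorem increment_comp (he : IsLocalCocycle r e) (hr : 0 < r) (hf : UniformContinuous f)
    {K : NNReal} {φ : ℝ → ℝ} (hφ : LipschitzWith K φ) (a b : ℝ) :
    increment e (f ∘ φ) a b = increment e f (φ a) (φ b) := by
  obtain ⟨A, hA⟩ := he.exists_isPrimitive hr hf
  rw [hA.increment_eq, (hA.comp hφ).increment_eq]
  rfl

/-- Increments over short pieces of a curve are given by the cocycle. -/
theorem increment_eq_of_dist_lt (he : IsLocalCocycle r e) (hr : 0 < r) (hf : UniformContinuous f)
    {a b : ℝ} (hab : a ≤ b) (h : ∀ s ∈ Icc a b, ∀ t ∈ Icc a b, dist (f s) (f t) < r) :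
    increment e f a b = e (f a) (f b) := by
  have hmem : ∀ t, max a (min b t) ∈ Icc a b := fun t =>
    ⟨le_max_left _ _, max_le hab (min_le_left _ _)⟩
  have hA : IsPrimitive e (f ∘ fun t => max a (min b t)) fun t => e (f a) (f (max a (min b t))) :=
    ⟨1, one_pos, fun s t _ => he _ _ _ (h _ (left_mem_Icc.2 hab) _ (hmem _))
      (h _ (hmem _) _ (hmem _)) (h _ (left_mem_Icc.2 hab) _ (hmem _))⟩
  rw [increment_congr he hr hf (hf.comp (lipschitzWith_clamp a b).uniformContinuous) hab,
    hA.increment_eq]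
  · simp [hab, he.self hr]
  · intro t ht
    simp [ht.1, ht.2]

/-- The primitives along uniformly close curves are related by the cocycle. -/
theorem increment_of_close (he : IsLocalCocycle r e) (hr : 0 < r) (hf : UniformContinuous f)
    {f' : ℝ → X} (hf' : UniformContinuous f') {a b : ℝ} (hab : a ≤ b)
    (h : ∀ t ∈ Icc a b, dist (f t) (f' t) < r / 2) :
    e (f a) (f' a) * increment e f' a b = increment e f a b * e (f b) (f' b) := by
  have hc := (lipschitzWith_clamp a b).uniformContinuous
  have hmem : ∀ t, max a (min b t) ∈ Icc a b := fun t =>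
    ⟨le_max_left _ _, max_le hab (min_le_left _ _)⟩
  have heq : ∀ t ∈ Icc a b, max a (min b t) = t := fun t ht => by simp [ht.1, ht.2]
  rw [increment_congr he hr hf (hf.comp hc) hab fun t ht => by simp [heq t ht],
    increment_congr he hr hf' (hf'.comp hc) hab fun t ht => by simp [heq t ht]]
  obtain ⟨A, hA⟩ := he.exists_isPrimitive hr (hf.comp hc)
  have hA' : IsPrimitive e (f' ∘ fun t => max a (min b t))
      fun t => A t * e (f (max a (min b t))) (f' (max a (min b t))) := by
    obtain ⟨η, hη, hp⟩ := hA
    obtain ⟨η₁, hη₁, h₁⟩ := Metric.uniformContinuous_iff.1 (hf.comp hc) (r / 2) (half_pos hr)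
    obtain ⟨η₂, hη₂, h₂⟩ := Metric.uniformContinuous_iff.1 (hf'.comp hc) (r / 2) (half_pos hr)
    obtain ⟨ρ, hρ, hlt⟩ := exists_between (show 0 < min η (min η₁ η₂) by positivity)
    simp only [lt_min_iff] at hlt
    refine ⟨ρ, hρ, fun s t hst => ?_⟩
    have k₁ := h₁ (a := s) (b := t) (by rw [Real.dist_eq]; linarith)
    have k₂ := h₂ (a := s) (b := t) (by rw [Real.dist_eq]; linarith)
    have k₃ := h _ (hmem s)
    have k₄ := h _ (hmem t)
    simp only [Function.comp_apply] at k₁ k₂ hp ⊢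
    -- The diagonal from `f s` to `f' t` is shared by the two triangles to be composed; the bounds
    -- `r / 2` keep it below `r`.
    have k₅ := dist_triangle (f (max a (min b s))) (f' (max a (min b s))) (f' (max a (min b t)))
    rw [← hp s t (by linarith), mul_assoc, mul_assoc, he, he] <;> linarith
  rw [hA.increment_eq, hA'.increment_eq]
  simp only [heq a (left_mem_Icc.2 hab), heq b (right_mem_Icc.2 hab)]
  group

/-- Triviality of the increment of loops is invariant under small perturbations. -/
theorem increment_eq_one_iff_of_close (he : IsLocalCocycle r e) (hr : 0 < r)
    (hf : UniformContinuous f) {f' : ℝ → X} (hf' : UniformContinuous f') {a b : ℝ} (hab : a ≤ b)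
    (h : ∀ t ∈ Icc a b, dist (f t) (f' t) < r / 2) (hfab : f a = f b) (hfab' : f' a = f' b) :
    increment e f a b = 1 ↔ increment e f' a b = 1 := by
  have := increment_of_close he hr hf hf' hab h
  rw [hfab, hfab'] at this
  constructor
  · intro h1
    rwa [h1, one_mul, mul_eq_left] at this
  · intro h1
    rwa [h1, mul_one, right_eq_mul] at this

theorem lipschitzWith_coe_addCircle (L : ℝ) : LipschitzWith 1 fun t : ℝ => (t : AddCircle L) := by
  refine LipschitzWith.of_dist_le_mul fun s t => ?_
  rw [dist_eq_norm, ← AddCircle.coe_sub, NNReal.coe_one, one_mul, Real.dist_eq]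
  exact QuotientAddGroup.norm_mk_le_norm

/-- Null-homotopic loops have trivial increment. -/
theorem increment_eq_one_of_nullhomotopic (he : IsLocalCocycle r e) (hr : 0 < r) {L : ℝ}
    (hL : 0 < L) {c : C(AddCircle L, X)} (hc : c.Nullhomotopic) :
    increment e (fun t : ℝ => c (t : AddCircle L)) 0 L = 1 := by
  have : Fact (0 < L) := ⟨hL⟩
  obtain ⟨y, ⟨H⟩⟩ := hc
  have hH : UniformContinuous H := CompactSpace.uniformContinuous_of_continuous H.continuous
  obtain ⟨δ, hδ, hd⟩ := Metric.uniformContinuous_iff.1 hH (r / 2) (half_pos hr)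
  have huc : ∀ τ : unitInterval, UniformContinuous fun t : ℝ => H (τ, (t : AddCircle L)) :=
    fun τ => hH.comp (uniformContinuous_const.prodMk (lipschitzWith_coe_addCircle L).uniformContinuous)
  -- A free homotopy moves the base point and may conjugate the increment, so only its triviality is
  -- followed.
  let φ : ℝ → Prop := fun τ =>
    increment e (fun t : ℝ => H (projIcc 0 1 zero_le_one τ, (t : AddCircle L))) 0 L = 1
  have h01 : φ 0 = φ 1 := by
    refine eq_of_locally_eq ⟨δ / 2, by positivity, fun s t hst => propext ?_⟩ 0 1
    refine increment_eq_one_iff_of_close he hr (huc _) (huc _) hL.le (fun u _ => hd ?_)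
      (by simp [AddCircle.coe_period]) (by simp [AddCircle.coe_period])
    rw [Prod.dist_eq, dist_self, max_eq_left dist_nonneg]
    refine lt_of_le_of_lt ?_ (lt_of_le_of_lt hst (half_lt_self hδ))
    have := (LipschitzWith.projIcc (zero_le_one (α := ℝ))).dist_le_mul s t
    simpa [Real.dist_eq] using this
  have h1 : φ 1 := by
    have hP : IsPrimitive e (fun _ : ℝ => y) fun _ => 1 :=
      ⟨1, one_pos, fun _ _ _ => by simp [he.self hr]⟩
    simp [φ, hP.increment_eq]
  rw [← h01] at h1
  simpa [φ] using h1

end Cocycle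

/-! ### Shortest loops with nontrivial increment -/

section Shortest

variable {X G : Type*} [MetricSpace X] [Group G] {r : ℝ} {e : X → X → G} {f g : ℝ → X}

theorem lipschitzWith_const_sub (c : ℝ) : LipschitzWith 1 fun u : ℝ => c - u :=
  LipschitzWith.of_dist_le_mul fun u v => by
    rw [Real.dist_eq, Real.dist_eq, NNReal.coe_one, one_mul, sub_sub_sub_cancel_left, abs_sub_comm]

theorem lipschitzWith_glue (hf : LipschitzWith 1 f) (hg : LipschitzWith 1 g) {t : ℝ}
    (h : f t = g t) : LipschitzWith 1 fun u => if u ≤ t then f u else g u := by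
  have key : ∀ u v, u ≤ v →
      dist (if u ≤ t then f u else g u) (if v ≤ t then f v else g v) ≤ v - u := by
    intro u v huv
    have hf' : ∀ u v, dist (f u) (f v) ≤ |u - v| := fun u v => by
      simpa [Real.dist_eq] using hf.dist_le_mul u v
    have hg' : ∀ u v, dist (g u) (g v) ≤ |u - v| := fun u v => by
      simpa [Real.dist_eq] using hg.dist_le_mul u v
    have huv' : |u - v| = v - u := by rw [abs_sub_comm, abs_of_nonneg (by linarith)]
    split_ifs with h1 h2 h2
    · exact (hf' u v).trans_eq huv'
    · have h3 := dist_triangle (f u) (f t) (g v)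
      have h4 := hf' u t
      have h5 := hg' t v
      rw [← h] at h5
      rw [abs_sub_comm, abs_of_nonneg (by linarith)] at h4 h5
      linarith
    · linarith
    · exact (hg' u v).trans_eq huv'
  refine LipschitzWith.of_dist_le_mul fun u v => ?_
  rw [NNReal.coe_one, one_mul, Real.dist_eq]
  rcases le_total u v with huv | huv
  · rw [abs_sub_comm, abs_of_nonneg (by linarith)]
    exact key u v huv
  · rw [abs_of_nonneg (by linarith), dist_comm]
    exact key v u huv

theorem increment_glue (he : IsLocalCocycle r e) (hr : 0 < r) (hf : LipschitzWith 1 f)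
    (hg : LipschitzWith 1 g) {a t b : ℝ} (hat : a ≤ t) (htb : t ≤ b) (h : f t = g t) :
    increment e (fun u => if u ≤ t then f u else g u) a b =
      increment e f a t * increment e g t b := by
  have hl := (lipschitzWith_glue hf hg h).uniformContinuous
  rw [← increment_mul he hr hl a t b,
    increment_congr he hr hl hf.uniformContinuous hat fun u hu => if_pos hu.2,
    increment_congr he hr hl hg.uniformContinuous htb fun u hu => ?_]
  split_ifs with hut
  · obtain rfl : u = t := le_antisymm hut hu.1
    exact h
  · rfl

/-- All rectifiable loops of length `< ℓ` have trivial increment. -/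
def ShortLoopsTrivial (e : X → X → G) (ℓ : ℝ) : Prop :=
  ∀ f : ℝ → X, LipschitzWith 1 f → ∀ a b, a ≤ b → b - a < ℓ → f a = f b → increment e f a b = 1

theorem ShortLoopsTrivial.increment_eq {ℓ : ℝ} (h : ShortLoopsTrivial e ℓ)
    (he : IsLocalCocycle r e) (hr : 0 < r) (hf : LipschitzWith 1 f) (hg : LipschitzWith 1 g)
    {a b c d : ℝ} (hab : a ≤ b) (hcd : c ≤ d) (hl : b - a + (d - c) < ℓ) (hac : f a = g c)
    (hbd : f b = g d) : increment e f a b = increment e g c d := by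
  -- Running `g` backwards, shifted to start at time `b`, closes `f` up to a loop of length `b - a +
  -- (d - c)`.
  have hφ : LipschitzWith 1 fun u : ℝ => d + b - u := lipschitzWith_const_sub _
  have hg' : LipschitzWith 1 (g ∘ fun u => d + b - u) := by simpa using hg.comp hφ
  have hb : f b = (g ∘ fun u => d + b - u) b := by simp [hbd]
  have := h _ (lipschitzWith_glue hf hg' hb) a (b + (d - c)) (by linarith) (by linarith) (by
    rw [if_pos hab, hac]
    split_ifs with h1
    · have : d = c := by linarith
      simp [this, ← hac, hbd]
    · simp only [Function.comp_apply]
      congr 1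
      ring)
  rw [increment_glue he hr hf hg' hab (by linarith) hb,
    increment_comp he hr hg.uniformContinuous hφ, mul_eq_one_iff_eq_inv, increment_symm, inv_inj]
    at this
  rw [increment_symm, this, increment_symm, inv_inv]
  congr 1 <;> ring

/-- For equi-Lipschitz curves, closeness at finitely many times is uniform closeness, so the
topology of pointwise convergence suffices for the compactness argument. -/
theorem dist_lt_of_lipschitzWith_of_grid {K : NNReal} (hf : LipschitzWith K f)
    (hg : LipschitzWith K g) {n : ℕ} (hn : K / n < r / 6) (hn0 : 0 < n)
    (h : ∀ i ∈ Finset.range (n + 1), dist (f (i / n)) (g (i / n)) < r / 6) {t : ℝ}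
    (ht : t ∈ Icc (0 : ℝ) 1) : dist (f t) (g t) < r / 2 := by
  have hn' : (0 : ℝ) < n := by exact_mod_cast hn0
  set i := ⌊t * n⌋₊
  have h1 : (i : ℝ) ≤ t * n := Nat.floor_le (mul_nonneg ht.1 hn'.le)
  have h2 : t * n < i + 1 := Nat.lt_floor_add_one _
  have hi : i ≤ n := by
    have : (i : ℝ) ≤ n := h1.trans (by nlinarith [ht.2])
    exact_mod_cast this
  have h3 : dist t (i / n) ≤ 1 / n := by
    rw [Real.dist_eq, abs_of_nonneg (by rw [sub_nonneg, div_le_iff₀ hn']; exact h1),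
      sub_le_iff_le_add, ← add_div, le_div_iff₀ hn']
    linarith
  have h4 : ∀ {f : ℝ → X}, LipschitzWith K f → dist (f t) (f (i / n)) < r / 6 := fun hf =>
    ((hf.dist_le_mul _ _).trans (mul_le_mul_of_nonneg_left h3 K.2)).trans_lt (by
      rwa [mul_one_div])
  have h5 := h4 hf
  have h6 := h4 hg
  have h7 := h i (Finset.mem_range.2 (by omega))
  have h8 := dist_triangle4 (f t) (f (i / n)) (g (i / n)) (g t)
  rw [dist_comm (g (i / n))] at h8
  linarith

/-- There is a shortest loop with nontrivial increment. -/
theorem exists_shortest_loop [CompactSpace X] (he : IsLocalCocycle r e) (hr : 0 < r)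
    (hf : LipschitzWith 1 f) {a b : ℝ} (hab : a ≤ b) (hfab : f a = f b)
    (hinc : increment e f a b ≠ 1) :
    ∃ L, 0 < L ∧ L ≤ b - a ∧ ShortLoopsTrivial e L ∧
      ∃ g, LipschitzWith 1 g ∧ g 0 = g L ∧ increment e g 0 L ≠ 1 := by
  set ℓ := b - a
  have hℓ : 0 ≤ ℓ := sub_nonneg.2 hab
  -- Loops are rescaled to `[0, 1]` and paired with a Lipschitz constant, which plays the role of
  -- length. Compactness then comes from Tychonoff's theorem.
  let C : Set (ℝ × (ℝ → X)) := {p | p.1 ∈ Icc 0 ℓ ∧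
    (∀ s t, dist (p.2 s) (p.2 t) ≤ p.1 * dist s t) ∧ p.2 0 = p.2 1}
  let S : Set (ℝ × (ℝ → X)) := C ∩ {p | increment e p.2 0 1 ≠ 1}
  have hLip : ∀ p ∈ C, LipschitzWith p.1.toNNReal p.2 := fun p hp =>
    LipschitzWith.of_dist_le_mul fun s t => by
      rw [Real.coe_toNNReal _ hp.1.1]
      exact hp.2.1 s t
  have hLip' : ∀ p ∈ C, LipschitzWith ℓ.toNNReal p.2 := fun p hp =>
    (hLip p hp).weaken (Real.toNNReal_le_toNNReal hp.1.2)
  have hC : IsClosed C := by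
    have h1 : IsClosed {p : ℝ × (ℝ → X) | ∀ s t, dist (p.2 s) (p.2 t) ≤ p.1 * dist s t} := by
      simp only [ofPred_forall]
      exact isClosed_iInter fun s => isClosed_iInter fun t =>
        isClosed_le (by fun_prop) (by fun_prop)
    have h2 : IsClosed {p : ℝ × (ℝ → X) | p.2 0 = p.2 1} :=
      isClosed_eq (by fun_prop) (by fun_prop)
    exact (isClosed_Icc.preimage continuous_fst).inter (h1.inter h2)
  have hS : IsClosed S := by
    refine isClosed_of_closure_subset fun p hp => ?_
    have hpC : p ∈ C := hC.closure_subset_iff.2 inter_subset_left hp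
    refine ⟨hpC, ?_⟩
    obtain ⟨n, hn⟩ := exists_nat_gt (ℓ / (r / 6))
    have hn' : (0 : ℝ) < n := lt_of_le_of_lt (by positivity) hn
    have hU : IsOpen {q : ℝ × (ℝ → X) | ∀ i ∈ Finset.range (n + 1),
        dist (p.2 (i / n)) (q.2 (i / n)) < r / 6} := by
      simp only [ofPred_forall]
      exact isOpen_biInter_finset fun i _ => isOpen_lt (by fun_prop) (by fun_prop)
    obtain ⟨q, hqU, hqC, hq⟩ := mem_closure_iff.1 hp _ hU fun i _ => by
      rw [dist_self]; positivity
    refine fun h => hq ((increment_eq_one_iff_of_close he hr (hLip' p hpC).uniformContinuous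
      (hLip' q hqC).uniformContinuous zero_le_one (fun t ht => ?_) hpC.2.2 hqC.2.2).1 h)
    refine dist_lt_of_lipschitzWith_of_grid (hLip' p hpC) (hLip' q hqC) (n := n) ?_
      (by exact_mod_cast hn') hqU ht
    rw [Real.coe_toNNReal _ hℓ, div_lt_comm₀ hn' (by positivity)]
    exact hn
  have hScomp : IsCompact S := (isCompact_Icc.prod isCompact_univ).of_isClosed_subset hS
    fun p hp => (⟨hp.1.1, mem_univ _⟩ : p ∈ Icc 0 ℓ ×ˢ univ)
  have hmem : ∀ g : ℝ → X, LipschitzWith 1 g → ∀ c d, c ≤ d → d - c ≤ ℓ → g c = g d →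
      increment e g c d ≠ 1 → (d - c, g ∘ fun t => c + (d - c) * t) ∈ S := by
    intro g hg c d hcd hle hgcd hne
    have hφ : LipschitzWith (d - c).toNNReal fun t : ℝ => c + (d - c) * t :=
      LipschitzWith.of_dist_le_mul fun s t => by
        rw [Real.coe_toNNReal _ (by linarith), Real.dist_eq, Real.dist_eq,
          add_sub_add_left_eq_sub, ← mul_sub, abs_mul, abs_of_nonneg (by linarith : 0 ≤ d - c)]
    refine ⟨⟨⟨by simpa using hcd, hle⟩, fun s t => ?_, by simpa using hgcd⟩, ?_⟩
    · have := (hg.comp hφ).dist_le_mul s t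
      simpa only [one_mul, Real.coe_toNNReal _ (by linarith : 0 ≤ d - c)] using this
    · simpa only [mem_ofPred_eq, increment_comp he hr hg.uniformContinuous hφ, mul_zero, add_zero,
        mul_one, add_sub_cancel] using hne
  obtain ⟨⟨L, g⟩, hmin, hL⟩ := hScomp.exists_isMinOn ⟨_, hmem f hf a b hab le_rfl hfab hinc⟩
    continuous_fst.continuousOn
  have hg := hLip _ hmin.1
  obtain ⟨⟨⟨hL0, hLℓ⟩, hgL, hg01⟩, hginc⟩ := hmin
  simp only at hL0 hLℓ hgL hg01 hginc hg
  have hLpos : 0 < L := by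
    refine hL0.lt_of_ne fun h0 => hginc ?_
    have hconst : ∀ s t, g s = g t := fun s t => by simpa [← h0] using hgL s t
    simp only
    rw [increment_eq_of_dist_lt he hr hg.uniformContinuous zero_le_one
      fun s _ t _ => by rwa [hconst s t, dist_self], hg01, he.self hr]
  have hφ : LipschitzWith L⁻¹.toNNReal fun t : ℝ => L⁻¹ * t :=
    LipschitzWith.of_dist_le_mul fun s t => by
      rw [Real.coe_toNNReal _ (by positivity), Real.dist_eq, Real.dist_eq, ← mul_sub, abs_mul,
        abs_of_nonneg (by positivity : 0 ≤ L⁻¹)]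
  refine ⟨L, hLpos, hLℓ, fun f' hf' c d hcd hlt hf'cd => ?_, g ∘ fun t => L⁻¹ * t, ?_, ?_, ?_⟩
  · by_contra hne
    have := hL (hmem f' hf' c d hcd (hlt.le.trans hLℓ) hf'cd hne)
    simp only [mem_ofPred_eq] at this
    linarith
  · refine (hg.comp hφ).weaken (le_of_eq ?_)
    rw [← Real.toNNReal_mul hL0, mul_inv_cancel₀ hLpos.ne', Real.toNNReal_one]
  · simpa [hLpos.ne'] using hg01
  · rw [increment_comp he hr hg.uniformContinuous hφ]
    simpa [hLpos.ne'] using hginc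

/-! ### Geodesics as curves on the whole line, and rigidity of shortest loops -/

theorem IsGeodesicSpace.exists_lipschitzWith (hX : IsGeodesicSpace X) (x y : X) :
    ∃ γ : ℝ → X, LipschitzWith 1 γ ∧ γ 0 = x ∧ γ (dist x y) = y := by
  obtain ⟨γ, h0, h1, h⟩ := hX x y
  have hmem : ∀ t, max 0 (min (dist x y) t) ∈ Icc 0 (dist x y) := fun t =>
    ⟨le_max_left _ _, max_le dist_nonneg (min_le_left _ _)⟩
  refine ⟨fun t => γ (max 0 (min (dist x y) t)), LipschitzWith.of_dist_le_mul fun s t => ?_,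
    by simp [h0], by simp [h1]⟩
  rw [h _ (hmem s) _ (hmem t), ← Real.dist_eq]
  exact (lipschitzWith_clamp 0 (dist x y)).dist_le_mul s t

/-- A geodesic from `x` to `y`, extended by constants. -/
noncomputable def IsGeodesicSpace.geodesic (hX : IsGeodesicSpace X) (x y : X) : ℝ → X :=
  (hX.exists_lipschitzWith x y).choose

theorem IsGeodesicSpace.lipschitzWith_geodesic (hX : IsGeodesicSpace X) (x y : X) :
    LipschitzWith 1 (hX.geodesic x y) := (hX.exists_lipschitzWith x y).choose_spec.1

@[simp]
theorem IsGeodesicSpace.geodesic_zero (hX : IsGeodesicSpace X) (x y : X) :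
    hX.geodesic x y 0 = x := (hX.exists_lipschitzWith x y).choose_spec.2.1

@[simp]
theorem IsGeodesicSpace.geodesic_dist (hX : IsGeodesicSpace X) (x y : X) :
    hX.geodesic x y (dist x y) = y := (hX.exists_lipschitzWith x y).choose_spec.2.2

theorem lipschitzWith_comp_sub_const (hf : LipschitzWith 1 f) (c : ℝ) :
    LipschitzWith 1 (f ∘ fun u => u - c) := by
  have : LipschitzWith 1 fun u : ℝ => u - c :=
    LipschitzWith.of_dist_le_mul fun u v => by simp
  simpa using hf.comp this

theorem increment_comp_sub_const (he : IsLocalCocycle r e) (hr : 0 < r) (hf : LipschitzWith 1 f)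
    (c a b : ℝ) : increment e (f ∘ fun u => u - c) a b = increment e f (a - c) (b - c) :=
  increment_comp (K := 1) he hr hf.uniformContinuous
    (LipschitzWith.of_dist_le_mul fun u v => by simp) a b

/-- A shortest loop with nontrivial increment is an isometrically embedded circle. -/
theorem le_dist_of_shortest (hX : IsGeodesicSpace X) (he : IsLocalCocycle r e) (hr : 0 < r)
    {L : ℝ} (hL : ShortLoopsTrivial e L) (hf : LipschitzWith 1 f) (hf0 : f 0 = f L)
    (hinc : increment e f 0 L ≠ 1) {s t : ℝ} (hs : 0 ≤ s) (hst : s ≤ t) (ht : t ≤ L) :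
    min (t - s) (L - (t - s)) ≤ dist (f s) (f t) := by
  by_contra! hlt
  rw [lt_min_iff] at hlt
  set σ := hX.geodesic (f s) (f t)
  have hσ : LipschitzWith 1 σ := hX.lipschitzWith_geodesic _ _
  set b := dist (f s) (f t)
  have hb : 0 ≤ b := dist_nonneg
  -- The arc from `s` to `t` followed by the chord is shorter than `L`, as `b < L - (t - s)`.
  have h1 : increment e f s t = increment e σ 0 b :=
    hL.increment_eq he hr hf hσ hst hb (by linarith) (by simp [σ]) (by simp [σ, b])
  have hrev : LipschitzWith 1 fun u : ℝ => L - u := lipschitzWith_const_sub _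
  have hgl : f s = (σ ∘ fun u => u - s) s := by simp [σ]
  -- The complementary arc together with the chord is shorter than `L`, as `b < t - s`.
  have h2 := hL.increment_eq (a := 0) (b := s + b) (c := 0) (d := L - t) he hr
    (lipschitzWith_glue hf (lipschitzWith_comp_sub_const hσ s) hgl)
    (by simpa using hf.comp hrev) (by linarith) (by linarith) (by linarith) (by simp [hs, hf0]) (by
      split_ifs with h
      · have hb0 : b = 0 := by linarith
        simp [hb0, dist_eq_zero.1 hb0]
      · simp [σ, b])
  rw [increment_glue he hr hf (lipschitzWith_comp_sub_const hσ s) hs (by linarith) hgl,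
    increment_comp_sub_const he hr hσ, sub_self, add_sub_cancel_left, ← h1,
    increment_comp he hr hf.uniformContinuous hrev,
    increment_mul he hr hf.uniformContinuous, sub_zero, sub_sub_cancel] at h2
  apply hinc
  rw [← increment_mul he hr hf.uniformContinuous 0 t L, h2,
    increment_mul he hr hf.uniformContinuous, increment_self]

theorem norm_coe_addCircle {L u : ℝ} (h0 : 0 ≤ u) (hL : u ≤ L) (hL0 : 0 < L) :
    ‖(u : AddCircle L)‖ = min u (L - u) := by
  rcases le_total u (L / 2) with h | h
  · rw [(AddCircle.norm_coe_eq_abs_iff L hL0.ne').2 (by rwa [abs_of_nonneg h0, abs_of_pos hL0]),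
      abs_of_nonneg h0, min_eq_left (by linarith)]
  · have h1 : (u : AddCircle L) = ((u - L : ℝ) : AddCircle L) := by
      rw [AddCircle.coe_sub, AddCircle.coe_period, sub_zero]
    have h2 : |u - L| = L - u := by rw [abs_sub_comm, abs_of_nonneg (by linarith)]
    rw [h1, (AddCircle.norm_coe_eq_abs_iff L hL0.ne').2 (by rw [h2, abs_of_pos hL0]; linarith),
      h2, min_eq_right (by linarith)]

theorem exists_isometric_circle (hX : IsGeodesicSpace X) (he : IsLocalCocycle r e) (hr : 0 < r)
    {L : ℝ} (hL0 : 0 < L) (hL : ShortLoopsTrivial e L) (hf : LipschitzWith 1 f) (hf0 : f 0 = f L)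
    (hinc : increment e f 0 L ≠ 1) :
    ∃ c : C(AddCircle L, X), Isometry c ∧ ∀ t ∈ Icc 0 L, c (t : AddCircle L) = f t := by
  have : Fact (0 < L) := ⟨hL0⟩
  have hcont : Continuous (AddCircle.liftIco L 0 f) :=
    AddCircle.liftIco_continuous (by simpa using hf0) hf.continuous.continuousOn
  have hco : ∀ t ∈ Ico 0 L, AddCircle.liftIco L 0 f (t : AddCircle L) = f t := fun t ht =>
    AddCircle.liftIco_coe_apply (by simpa using ht)
  refine ⟨⟨_, hcont⟩, Isometry.of_dist_eq fun x y => ?_, fun t ht => ?_⟩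
  · obtain ⟨s, hs, rfl⟩ : x ∈ (fun t : ℝ => (t : AddCircle L)) '' Ico 0 (0 + L) :=
      AddCircle.coe_image_Ico_eq L 0 ▸ mem_univ x
    obtain ⟨t, ht, rfl⟩ : y ∈ (fun t : ℝ => (t : AddCircle L)) '' Ico 0 (0 + L) :=
      AddCircle.coe_image_Ico_eq L 0 ▸ mem_univ y
    rw [zero_add] at hs ht
    simp only [ContinuousMap.coe_mk, hco s hs, hco t ht]
    have key : ∀ s t, s ∈ Ico 0 L → t ∈ Ico 0 L → s ≤ t →
        dist (f s) (f t) = dist (s : AddCircle L) (t : AddCircle L) := by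
      intro s t hs ht hst
      rw [dist_comm (s : AddCircle L), dist_eq_norm, ← AddCircle.coe_sub,
        norm_coe_addCircle (by linarith) (by linarith [hs.1, ht.2]) hL0]
      refine le_antisymm (le_min ?_ ?_)
        (le_dist_of_shortest hX he hr hL hf hf0 hinc hs.1 hst ht.2.le)
      · have := hf.dist_le_mul s t
        rwa [NNReal.coe_one, one_mul, Real.dist_eq, abs_sub_comm, abs_of_nonneg (by linarith)]
          at this
      · have h1 := hf.dist_le_mul s 0
        have h2 := hf.dist_le_mul L t
        rw [NNReal.coe_one, one_mul, Real.dist_eq, abs_of_nonneg (by linarith [hs.1, ht.2])]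
          at h1 h2
        rw [← hf0] at h2
        linarith [dist_triangle (f s) (f 0) (f t)]
    rcases le_total s t with hst | hst
    · exact key s t hs ht hst
    · rw [dist_comm, key t s ht hs hst, dist_comm]
  · rcases ht.2.lt_or_eq with h | rfl
    · exact hco t ⟨ht.1, h⟩
    · have := hco 0 ⟨le_rfl, hL0⟩
      simp only [ContinuousMap.coe_mk, AddCircle.coe_period]
      rw [← hf0, ← this]
      rfl

/-- The cocycle given by the increments of `e` along geodesics. -/
noncomputable def IsGeodesicSpace.geodesicCocycle (hX : IsGeodesicSpace X) (e : X → X → G)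
    (x y : X) : G :=
  increment e (hX.geodesic x y) 0 (dist x y)

theorem IsGeodesicSpace.geodesicCocycle_eq (hX : IsGeodesicSpace X) (he : IsLocalCocycle r e)
    (hr : 0 < r) {x y : X} (h : dist x y < r) : hX.geodesicCocycle e x y = e x y := by
  have hl := hX.lipschitzWith_geodesic x y
  rw [geodesicCocycle, increment_eq_of_dist_lt he hr hl.uniformContinuous dist_nonneg]
  · simp
  · intro s hs t ht
    have h1 := hl.dist_le_mul s t
    have h2 := Real.dist_le_of_mem_Icc hs ht
    simp only [NNReal.coe_one, one_mul] at h1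
    linarith

/-- The perimeter of a geodesic triangle with sides `< δ` is `< 3 * δ`. Hence `e` is extended from
scale `r` to scale `δ`, however large, as long as short loops are trivial. -/
theorem IsGeodesicSpace.isLocalCocycle_geodesicCocycle (hX : IsGeodesicSpace X)
    (he : IsLocalCocycle r e) (hr : 0 < r) {δ : ℝ} (h : ShortLoopsTrivial e (3 * δ)) :
    IsLocalCocycle δ (hX.geodesicCocycle e) := by
  intro x y z hxy hyz hxz
  have h1 := hX.lipschitzWith_geodesic x y
  have h2 := hX.lipschitzWith_geodesic y z
  have h3 := hX.lipschitzWith_geodesic x z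
  have hgl : hX.geodesic x y (dist x y) =
    (hX.geodesic y z ∘ fun u => u - dist x y) (dist x y) := by simp
  have hd : (0 : ℝ) ≤ dist y z := dist_nonneg
  have := h.increment_eq (a := 0) (b := dist x y + dist y z) he hr
    (lipschitzWith_glue h1 (lipschitzWith_comp_sub_const h2 _) hgl) h3 (by positivity)
    (dist_nonneg (x := x) (y := z)) (by linarith) (by simp) (by
      split_ifs with h
      · have h0 : dist y z = 0 := by linarith
        simp [dist_eq_zero.1 h0]
      · simp)
  rw [increment_glue he hr h1 (lipschitzWith_comp_sub_const h2 _) dist_nonneg (by linarith) hgl,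
    increment_comp_sub_const he hr h2, sub_self, add_sub_cancel_left] at this
  exact this

end Shortest

/-! ### From nontrivial increments to non-null closed geodesics -/

theorem exists_shortest_closedGeodesic {X G : Type*} [MetricSpace X] [CompactSpace X] [Group G]
    {r : ℝ} {e : X → X → G} (hX : IsGeodesicSpace X) (he : IsLocalCocycle r e) (hr : 0 < r)
    {ℓ : ℝ} (h : ¬ ShortLoopsTrivial e ℓ) :
    ∃ L, 0 < L ∧ L < ℓ ∧ ShortLoopsTrivial e L ∧ ∃ c : C(AddCircle L, X), Isometry c ∧
      increment e (fun t : ℝ => c (t : AddCircle L)) 0 L ≠ 1 := by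
  unfold ShortLoopsTrivial at h
  push Not at h
  obtain ⟨f, hf, a, b, hab, hlt, hfab, hinc⟩ := h
  obtain ⟨L, hL0, hL, hs, g, hg, hg0, hginc⟩ := exists_shortest_loop he hr hf hab hfab hinc
  obtain ⟨c, hc, hcg⟩ := exists_isometric_circle hX he hr hL0 hs hg hg0 hginc
  refine ⟨L, hL0, hL.trans_lt hlt, hs, c, hc, ?_⟩
  rwa [increment_congr (f := fun t : ℝ => c (t : AddCircle L)) he hr
    (hc.lipschitz.comp (lipschitzWith_coe_addCircle L)).uniformContinuous
    hg.uniformContinuous hL0.le hcg]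

theorem isClosedGeodesic_of_isometry {X : Type*} [MetricSpace X] {L : ℝ} (hL : 0 < L)
    {c : C(AddCircle L, X)} (hc : Isometry c) : IsClosedGeodesic L c :=
  ⟨hL, 1, one_pos, fun s t _ => hc.dist_eq s t⟩

theorem mem_nonNullGeodesicLengths_of_isometry {X G : Type*} [MetricSpace X] [Group G]
    {r : ℝ} {e : X → X → G} (he : IsLocalCocycle r e) (hr : 0 < r) {L : ℝ} (hL : 0 < L)
    {c : C(AddCircle L, X)} (hc : Isometry c)
    (hinc : increment e (fun t : ℝ => c (t : AddCircle L)) 0 L ≠ 1) :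
    L ∈ nonNullGeodesicLengths X :=
  ⟨c, isClosedGeodesic_of_isometry hL hc,
    fun h => hinc (increment_eq_one_of_nullhomotopic he hr hL h)⟩

/-! ### Products of cocycles along chains -/

section ChainProd

variable {X G : Type*} [Group G] {e : X → X → G}

/-- The product of `e` over consecutive members of a chain. -/
def chainProd (e : X → X → G) : List X → G
  | [] => 1
  | [_] => 1
  | x :: y :: l => e x y * chainProd e (y :: l)

@[simp]
theorem chainProd_singleton (x : X) : chainProd e [x] = 1 := rfl

@[simp]
theorem chainProd_cons_cons (x y : X) (l : List X) :
    chainProd e (x :: y :: l) = e x y * chainProd e (y :: l) := rfl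

theorem chainProd_append_cons (l₁ : List X) (x : X) (l₂ : List X) :
    chainProd e (l₁ ++ x :: l₂) = chainProd e (l₁ ++ [x]) * chainProd e (x :: l₂) := by
  induction l₁ with
  | nil => simp
  | cons a l ih =>
    cases l with
    | nil => simp
    | cons b l =>
      simp only [List.cons_append, chainProd_cons_cons, mul_assoc] at ih ⊢
      rw [ih]

variable [MetricSpace X]

theorem chainProd_congr {e' : X → X → G} {ε : ℝ} (h : ∀ x y, dist x y < ε → e x y = e' x y)
    {α : List X} (hα : α.IsChain fun x y => dist x y < ε) :
    chainProd e α = chainProd e' α := by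
  induction α with
  | nil => rfl
  | cons a l ih =>
    cases l with
    | nil => rfl
    | cons b l =>
      rw [List.isChain_cons_cons] at hα
      simp [h a b hα.1, ih hα.2]

theorem BasicMove.symm {ε : ℝ} {α β : List X} (h : BasicMove ε α β) : BasicMove ε β α :=
  ⟨h.2.1, h.1, h.2.2.1.symm, h.2.2.2.1.symm, h.2.2.2.2.symm⟩

/-- An interior insertion is one use of the cocycle identity. At either end, the fixed endpoint
forces the new point to repeat its neighbour, and `e x x = 1`. -/
theorem IsLocalCocycle.chainProd_eq_of_basicMove {δ : ℝ} (he : IsLocalCocycle δ e) (hδ : 0 < δ)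
    {α β : List X} (h : BasicMove δ α β) : chainProd e α = chainProd e β := by
  have key : ∀ {α β : List X}, BasicMove δ α β → InsertsPoint α β →
      chainProd e α = chainProd e β := by
    rintro _ _ ⟨⟨h1, h2⟩, ⟨-, h3⟩, h4, h5, -⟩ ⟨l₁, l₂, x, rfl, rfl⟩
    rcases l₁.eq_nil_or_concat with rfl | ⟨l₁, a, rfl⟩
    · cases l₂ with
      | nil => simp at h1
      | cons b l₂ =>
        obtain rfl : b = x := by simpa using h4
        simp [he.self hδ]
    · cases l₂ with
      | nil =>
        obtain rfl : a = x := by simpa using h5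
        simp only [List.concat_eq_append, List.append_nil, List.append_assoc, List.cons_append,
          List.nil_append]
        rw [chainProd_append_cons l₁ a [a]]
        simp [he.self hδ]
      | cons b l₂ =>
        simp only [List.concat_eq_append, List.append_assoc, List.cons_append, List.nil_append]
          at h2 h3 ⊢
        have h2' := (List.isChain_append.1 h2).2.1
        have h3' := (List.isChain_append.1 h3).2.1
        simp only [List.isChain_cons_cons] at h2' h3'
        rw [chainProd_append_cons l₁ a (b :: l₂), chainProd_append_cons l₁ a (x :: b :: l₂)]
        simp only [chainProd_cons_cons]
        rw [← mul_assoc (e a x), he a x b h3'.1 h3'.2.1 h2'.1]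
  rcases h.2.2.2.2 with h' | h'
  · exact key h h'
  · exact (key h.symm h').symm

theorem IsLocalCocycle.chainProd_eq_one {δ : ℝ} (he : IsLocalCocycle δ e) (hδ : 0 < δ)
    {x : X} {α : List X} (h : IsEpsNull δ x α) : chainProd e α = 1 := by
  have : ∀ {β}, Relation.ReflTransGen (BasicMove δ) α β → chainProd e α = chainProd e β := by
    intro β hβ
    induction hβ with
    | refl => rfl
    | tail _ hm ih => exact ih.trans (he.chainProd_eq_of_basicMove hδ hm)
  exact this h.2.2

end ChainProd

/-! ### The cocycle of `ε`-homotopy classes of chains -/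

section ChainFiber

variable {X : Type*} [MetricSpace X] {ε : ℝ}

theorem IsEpsChain.cons {x y : X} {α : List X} (hα : IsEpsChain ε α) (hy : α.head? = some y)
    (h : dist x y < ε) : IsEpsChain ε (x :: α) := by
  obtain ⟨l, rfl⟩ := List.head?_eq_some_iff.1 hy
  exact ⟨by simp, List.isChain_cons_cons.2 ⟨h, hα.2⟩⟩

theorem BasicMove.cons {x y : X} {α β : List X} (h : BasicMove ε α β) (hy : α.head? = some y)
    (hxy : dist x y < ε) : BasicMove ε (x :: α) (x :: β) := by
  obtain ⟨h1, h2, h3, h4, h5⟩ := h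
  refine ⟨h1.cons hy hxy, h2.cons (h3 ▸ hy) hxy, rfl, ?_, ?_⟩
  · simp [List.getLast?_cons, h4]
  · refine h5.imp ?_ ?_ <;>
    · rintro ⟨l₁, l₂, z, rfl, rfl⟩
      exact ⟨x :: l₁, l₂, z, rfl, rfl⟩

theorem basicMove_remove_second {x y z : X} {l : List X} (h : IsEpsChain ε (x :: y :: z :: l))
    (hxz : dist x z < ε) : BasicMove ε (x :: y :: z :: l) (x :: z :: l) := by
  have h' := h.2
  simp only [List.isChain_cons_cons] at h'
  exact ⟨h, ⟨by simp, List.isChain_cons_cons.2 ⟨hxz, h'.2.2⟩⟩, rfl, by simp [List.getLast?_cons],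
    Or.inr ⟨[x], z :: l, y, rfl, rfl⟩⟩

theorem basicMove_remove_first {x : X} {l : List X} (h : IsEpsChain ε (x :: x :: l)) :
    BasicMove ε (x :: x :: l) (x :: l) :=
  ⟨h, ⟨by simp, (List.isChain_cons_cons.1 h.2).2⟩, rfl, by simp [List.getLast?_cons],
    Or.inr ⟨[], x :: l, x, rfl, rfl⟩⟩

/-- The `ε`-homotopy classes of `ε`-chains that start at `x`. -/
def ChainFiber (ε : ℝ) (x : X) : Type _ :=
  Quot fun α β : {α : List X // IsEpsChain ε α ∧ α.head? = some x} => BasicMove ε α.1 β.1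

/-- The class of a chain. -/
def ChainFiber.mk {x : X} (α : List X) (hα : IsEpsChain ε α) (hx : α.head? = some x) :
    ChainFiber ε x :=
  Quot.mk _ ⟨α, hα, hx⟩

theorem ChainFiber.sound {x : X} {α β : List X} (h : BasicMove ε α β) (hx : α.head? = some x) :
    ChainFiber.mk α h.1 hx = ChainFiber.mk β h.2.1 (h.2.2.1 ▸ hx) :=
  Quot.sound h

theorem ChainFiber.exact {x : X} {α β : List X} {hα : IsEpsChain ε α} {hx : α.head? = some x}
    {hβ : IsEpsChain ε β} {hx' : β.head? = some x} (h : mk α hα hx = mk β hβ hx') :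
    EpsHomotopic ε α β := by
  refine ⟨hα, hβ, ?_⟩
  have key : ∀ {a b : {α : List X // IsEpsChain ε α ∧ α.head? = some x}},
      Relation.EqvGen (fun α β => BasicMove ε α.1 β.1) a b →
      Relation.ReflTransGen (BasicMove ε) a.1 b.1 := by
    intro a b hab
    induction hab with
    | rel _ _ h => exact .single h
    | refl => exact .refl
    | symm _ _ _ ih =>
      have : Std.Symm (BasicMove (X := X) ε) := ⟨fun _ _ h => h.symm⟩
      exact symm ih
    | trans _ _ _ _ _ ih₁ ih₂ => exact ih₁.trans ih₂
  exact key (Quot.eqvGen_exact h)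

/-- Prepending a point to a chain. -/
def ChainFiber.cons {x y : X} (h : dist x y < ε) : ChainFiber ε y → ChainFiber ε x :=
  Quot.map (fun α => ⟨x :: α.1, α.2.1.cons α.2.2 h, rfl⟩) fun α _ hm => hm.cons α.2.2 h

theorem ChainFiber.cons_cons {x y z : X} (hxy : dist x y < ε) (hyz : dist y z < ε)
    (hxz : dist x z < ε) (q : ChainFiber ε z) : cons hxy (cons hyz q) = cons hxz q := by
  obtain ⟨α, hα, hz⟩ := q
  obtain ⟨l, rfl⟩ := List.head?_eq_some_iff.1 hz
  exact ChainFiber.sound (basicMove_remove_second ((hα.cons rfl hyz).cons rfl hxy) hxz) rfl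

theorem ChainFiber.cons_self {x : X} (h : dist x x < ε) (q : ChainFiber ε x) : cons h q = q := by
  obtain ⟨α, hα, hz⟩ := q
  obtain ⟨l, rfl⟩ := List.head?_eq_some_iff.1 hz
  exact ChainFiber.sound (basicMove_remove_first (hα.cons rfl h)) rfl

/-- Prepending a point is a bijection of classes of chains. -/
def ChainFiber.consEquiv (hε : 0 < ε) {x y : X} (h : dist x y < ε) :
    ChainFiber ε y ≃ ChainFiber ε x where
  toFun := cons h
  invFun := cons (by rwa [dist_comm])
  left_inv q := by
    rw [cons_cons _ _ (by rwa [dist_self]), cons_self]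
  right_inv q := by
    rw [cons_cons _ _ (by rwa [dist_self]), cons_self]

/-- Fibres over points at distance `< ε` are in bijection by prepending, so the existence of a
bijection is a locally constant proposition. -/
theorem ChainFiber.nonempty_equiv [PreconnectedSpace X] (hε : 0 < ε) (x y : X) :
    Nonempty (ChainFiber ε x ≃ ChainFiber ε y) := by
  have hloc : IsLocallyConstant fun y : X => Nonempty (ChainFiber ε x ≃ ChainFiber ε y) := by
    rw [IsLocallyConstant.iff_eventually_eq]
    intro z
    filter_upwards [Metric.ball_mem_nhds z hε] with y hy
    exact propext ⟨fun ⟨φ⟩ => ⟨φ.trans (consEquiv hε ((dist_comm z y).trans_lt hy))⟩,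
      fun ⟨φ⟩ => ⟨φ.trans (consEquiv hε hy)⟩⟩
  have := hloc.apply_eq_of_preconnectedSpace x y
  exact this ▸ ⟨Equiv.refl _⟩

/-- There is a local cocycle at scale `ε` whose products over `ε`-loops detect whether
they are `ε`-null. -/
theorem exists_isLocalCocycle_detecting_null {X : Type u} [MetricSpace X] [PreconnectedSpace X]
    [Nonempty X] {ε : ℝ} (hε : 0 < ε) :
    ∃ (ι : Type u) (e : X → X → Equiv.Perm ι), IsLocalCocycle ε e ∧
      ∀ x α, IsEpsLoop ε x α → chainProd e α = 1 → IsEpsNull ε x α := by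
  obtain ⟨x₀⟩ := ‹Nonempty X›
  -- Arbitrary identifications of all fibres with one of them turn prepending a point into a
  -- permutation.
  let τ : ∀ x, ChainFiber ε x ≃ ChainFiber ε x₀ := fun x =>
    (ChainFiber.nonempty_equiv hε x x₀).some
  let e : X → X → Equiv.Perm (ChainFiber ε x₀) := fun x y => open Classical in
    if h : dist x y < ε then (τ y).symm.trans ((ChainFiber.consEquiv hε h).trans (τ x)) else 1
  have he : ∀ {x y} (h : dist x y < ε) q, e x y (τ y q) = τ x (ChainFiber.cons h q) := by
    intro x y h q
    simp [e, h, ChainFiber.consEquiv]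
  refine ⟨ChainFiber ε x₀, e, fun x y z hxy hyz hxz => ?_, fun x α hα h1 => ?_⟩
  · ext q
    obtain ⟨q, rfl⟩ := (τ z).surjective q
    rw [Equiv.Perm.mul_apply, he hyz, he hxy, he hxz, ChainFiber.cons_cons hxy hyz hxz]
  -- The product along a chain carries the class of its last point to the class of the chain. For a
  -- loop with product `1` the two classes coincide.
  · have key : ∀ (l : List X) (x y : X) (hc : IsEpsChain ε (x :: l)),
        (x :: l).getLast? = some y →
        chainProd e (x :: l) (τ y (ChainFiber.mk [y] ⟨by simp, by simp⟩ rfl)) =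
          τ x (ChainFiber.mk (x :: l) hc rfl) := by
      intro l
      induction l with
      | nil =>
        intro x y hc hy
        obtain rfl : x = y := by simpa using hy
        rfl
      | cons b l ih =>
        intro x y hc hy
        have hc' := List.isChain_cons_cons.1 hc.2
        rw [chainProd_cons_cons, Equiv.Perm.mul_apply,
          ih b y ⟨by simp, hc'.2⟩ (by simpa [List.getLast?_cons] using hy), he hc'.1]
        rfl
    obtain ⟨hc, hh, hl⟩ := hα
    obtain ⟨l, rfl⟩ := List.head?_eq_some_iff.1 hh
    have := key l x x hc hl
    rw [h1, Equiv.Perm.one_apply] at this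
    exact ChainFiber.exact ((τ x).injective this).symm

end ChainFiber

/-! ### The lower bound -/

section LowerBound

variable {X : Type*} [MetricSpace X]

/-- A path along a geodesic from `x` to `y`. -/
noncomputable def IsGeodesicSpace.geodesicPath (hX : IsGeodesicSpace X) (x y : X) : Path x y where
  toFun t := hX.geodesic x y (t * dist x y)
  continuous_toFun := (hX.lipschitzWith_geodesic x y).continuous.comp (by fun_prop)
  source' := by simp
  target' := by simp

theorem IsGeodesicSpace.pathConnectedSpace (hX : IsGeodesicSpace X) [Nonempty X] :
    PathConnectedSpace X :=
  ⟨‹_›, fun x y => ⟨hX.geodesicPath x y⟩⟩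

/-- Otherwise `geodesicCocycle` would be a cocycle at scale `δ` with the same product along `α` as
`e`. That product is `1` since `α` is `δ`-null, and `α` would be `ε`-null. -/
theorem IsEpsCritical.exists_nonNullGeodesicLength [CompactSpace X] (hX : IsGeodesicSpace X)
    {ε : ℝ} (hε : 0 < ε) {x : X} {α : List X} (hα : IsEpsCritical ε x α) {δ : ℝ} (hδ : ε < δ) :
    ∃ L ∈ nonNullGeodesicLengths X, L < 3 * δ := by
  have : Nonempty X := ⟨x⟩
  have := hX.pathConnectedSpace
  obtain ⟨hloop, hnot, hnull⟩ := hα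
  obtain ⟨ι, e, he, hdetect⟩ := exists_isLocalCocycle_detecting_null (X := X) hε
  have hshort : ¬ ShortLoopsTrivial e (3 * δ) := by
    intro hs
    have h1 := (hX.isLocalCocycle_geodesicCocycle he hε hs).chainProd_eq_one (hε.trans hδ)
      (hnull δ hδ)
    rw [chainProd_congr (fun x y h => hX.geodesicCocycle_eq he hε h) hloop.1.2] at h1
    exact hnot (hdetect x α hloop h1)
  obtain ⟨L, hL0, hL, -, c, hc, hinc⟩ := exists_shortest_closedGeodesic hX he hε hshort
  exact ⟨L, mem_nonNullGeodesicLengths_of_isometry he hε hL0 hc hinc, hL⟩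

theorem oneSystole_div_three_le [CompactSpace X] (hX : IsGeodesicSpace X) {ε : ℝ}
    (hε : ε ∈ homotopyCriticalSpectrum X) : oneSystole X / 3 ≤ ENNReal.ofReal ε := by
  obtain ⟨hε0, x, α, hα⟩ := hε
  have key : oneSystole X ≤ ENNReal.ofReal (3 * ε) := by
    refine ENNReal.le_of_forall_pos_le_add fun η hη _ => ?_
    obtain ⟨L, hL, hlt⟩ := hα.exists_nonNullGeodesicLength hX hε0
      (show ε < ε + η / 3 by simpa using hη)
    refine (iInf₂_le L hL).trans ((ENNReal.ofReal_le_ofReal hlt.le).trans ?_)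
    rw [← ENNReal.ofReal_coe_nnreal (p := η), 
      ← ENNReal.ofReal_add (by positivity : 0 ≤ 3 * ε) η.coe_nonneg]
    exact ENNReal.ofReal_le_ofReal (by linarith)
  rw [ENNReal.ofReal_mul (by norm_num), ENNReal.ofReal_ofNat, mul_comm] at key
  exact ENNReal.div_le_of_le_mul key

end LowerBound

/-! ### Semilocally simply connected spaces -/

section Semilocal

/-- A path is closed up to a loop at `x₀` by chosen connecting paths. The opposite group makes
products follow the order of concatenation. -/
theorem exists_group_of_path_classes (X : Type u) [TopologicalSpace X] [PathConnectedSpace X] :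
    ∃ (G : Type u) (_ : Group G) (h : ∀ {x y : X}, Path x y → G),
      (∀ {x y : X} (γ γ' : Path x y), h γ = h γ' ↔ γ.Homotopic γ') ∧
      ∀ {x y z : X} (γ : Path x y) (γ' : Path y z), h (γ.trans γ') = h γ * h γ' := by
  obtain ⟨x₀⟩ := PathConnectedSpace.nonempty (X := X)
  let c : ∀ x, Path.Homotopic.Quotient x₀ x := fun x =>
    .mk (PathConnectedSpace.somePath x₀ x)
  have hcancel : ∀ {x y z : X} (p : Path.Homotopic.Quotient x y) (q : Path.Homotopic.Quotient y z),
      p.symm.trans (p.trans q) = q := fun p q => by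
    rw [← Path.Homotopic.Quotient.trans_assoc]
    simp
  refine ⟨(FundamentalGroup X x₀)ᵐᵒᵖ, inferInstance, fun {x y} γ =>
    .op (((c x).trans (.mk γ)).trans (c y).symm), fun {x y} γ γ' => ?_, fun {x y z} γ γ' => ?_⟩
  · rw [← Path.Homotopic.Quotient.eq]
    refine ⟨fun h => ?_, fun h => by simp only [h]⟩
    have h1 := congrArg (fun q => ((c x).symm.trans (q.trans (c y)))) (MulOpposite.op_injective h)
    simpa [hcancel] using h1
  · refine congrArg MulOpposite.op (?_ : _ = Path.Homotopic.Quotient.trans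
      (((c x).trans (.mk γ)).trans (c y).symm) (((c y).trans (.mk γ')).trans (c z).symm))
    simp [hcancel]

theorem homotopic_of_trans_symm_homotopic_refl {X : Type*} [TopologicalSpace X] {x y : X}
    {γ γ' : Path x y} (h : (γ.trans γ'.symm).Homotopic (Path.refl x)) : γ.Homotopic γ' := by
  rw [← Path.Homotopic.Quotient.eq] at h ⊢
  have := congrArg (fun q => q.trans (.mk γ')) h
  simpa using this

/-- A Lebesgue number makes the neighbourhoods uniform; `γ` followed by the reverse of `γ'` is a
loop in one of them. -/
theorem SemilocallySimplyConnected.exists_ball {X : Type*} [MetricSpace X] [CompactSpace X]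
    (h : SemilocallySimplyConnected X) : ∃ r > 0, ∀ (z x y : X) (γ γ' : Path x y),
      range γ ⊆ Metric.ball z r → range γ' ⊆ Metric.ball z r → γ.Homotopic γ' := by
  choose U hU hxU hnull using h
  obtain ⟨r, hr, hball⟩ := lebesgue_number_lemma_of_metric (isCompact_univ (X := X)) hU
    fun x _ => mem_iUnion.2 ⟨x, hxU x⟩
  refine ⟨r, hr, fun z x y γ γ' hγ hγ' => ?_⟩
  obtain ⟨i, hi⟩ := hball z (mem_univ z)
  apply homotopic_of_trans_symm_homotopic_refl
  apply hnull i
  rw [Path.trans_range, Path.symm_range]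
  exact union_subset (hγ.trans hi) (hγ'.trans hi)

theorem IsGeodesicSpace.range_geodesicPath_subset {X : Type*} [MetricSpace X]
    (hX : IsGeodesicSpace X) {x y z : X} {r : ℝ} (h : dist x z + dist x y < r) :
    range (hX.geodesicPath x y) ⊆ Metric.ball z r := by
  rintro _ ⟨t, rfl⟩
  have h1 := (hX.lipschitzWith_geodesic x y).dist_le_mul (t * dist x y) 0
  rw [hX.geodesic_zero, NNReal.coe_one, one_mul, dist_zero_right, Real.norm_eq_abs,
    abs_of_nonneg (mul_nonneg t.2.1 dist_nonneg)] at h1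
  have h2 : (t : ℝ) * dist x y ≤ dist x y := mul_le_of_le_one_left dist_nonneg t.2.2
  rw [Metric.mem_ball]
  have h3 := dist_triangle (hX.geodesicPath x y t) x z
  have h4 : dist (hX.geodesicPath x y t) x ≤ t * dist x y := h1
  linarith

/-- In a semilocally simply connected space there is a local cocycle detecting null-homotopic
loops. -/
theorem SemilocallySimplyConnected.exists_isLocalCocycle {X : Type u} [MetricSpace X]
    [CompactSpace X] [Nonempty X] (hs : SemilocallySimplyConnected X) (hX : IsGeodesicSpace X) :
    ∃ (G : Type u) (_ : Group G) (e : X → X → G), ∃ r > 0, IsLocalCocycle r e ∧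
      ∀ (x : X) (γ : Path x x), increment e γ.extend 0 1 = 1 → γ.Homotopic (Path.refl x) := by
  have := hX.pathConnectedSpace
  obtain ⟨R, hR, hball⟩ := hs.exists_ball
  obtain ⟨G, _, h, heq, hmul⟩ := exists_group_of_path_classes X
  have hrefl : ∀ x, h (Path.refl x) = 1 := fun x => by
    have := hmul (Path.refl x) (Path.refl x)
    rw [Path.refl_trans_refl] at this
    simpa using this
  refine ⟨G, ‹_›, fun x y => h (hX.geodesicPath x y), R / 2, half_pos hR, ?_, ?_⟩
  · intro x y z hxy hyz hxz
    rw [← hmul, heq]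
    refine hball x _ _ _ _ ?_ (hX.range_geodesicPath_subset (by rw [dist_self]; linarith))
    rw [Path.trans_range]
    refine union_subset (hX.range_geodesicPath_subset (by rw [dist_self]; linarith))
      (hX.range_geodesicPath_subset (by rw [dist_comm y x]; linarith))
  · intro x γ hγ
    let p : ℝ → unitInterval := projIcc 0 1 zero_le_one
    -- The primitive is the class of the initial segment of `γ`: a short piece of `γ` is homotopic
    -- to the geodesic between its ends, both lying in one ball of radius `R`.
    have hA : IsPrimitive (fun x y => h (hX.geodesicPath x y)) γ.extend
        fun t => h (γ.subpath 0 (p t)) := by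
      obtain ⟨η, hη, hd⟩ := Metric.uniformContinuous_iff.1
        (CompactSpace.uniformContinuous_of_continuous γ.continuous) (R / 2) (half_pos hR)
      refine ⟨η / 2, half_pos hη, fun s t hst => ?_⟩
      have hpst : dist (p s) (p t) < η := by
        have := (LipschitzWith.projIcc (zero_le_one (α := ℝ))).dist_le_mul s t
        rw [NNReal.coe_one, one_mul, Real.dist_eq] at this
        exact this.trans_lt (by linarith)
      change h _ * h (hX.geodesicPath (γ (p s)) (γ (p t))) = h (γ.subpath 0 (p t))
      rw [← (heq _ _).2 ⟨Path.Homotopy.subpathTransSubpath γ 0 (p s) (p t)⟩, hmul]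
      congr 1
      rw [heq]
      refine hball (γ (p s)) _ _ _ _ (hX.range_geodesicPath_subset ?_) ?_
      · rw [dist_self, zero_add]
        linarith [hd hpst]
      · rw [Path.range_subpath]
        rintro _ ⟨u, hu, rfl⟩
        have : dist u (p s) < η := by
          refine lt_of_le_of_lt ?_ hpst
          rw [dist_comm]
          exact Real.dist_left_le_of_mem_uIcc (mem_uIcc.2 (mem_uIcc.1 hu))
        exact (hd this).trans (half_lt_self hR)
    have hcast : ∀ {x y x' y' : X} (γ : Path x y) (hx : x' = x) (hy : y' = y),
        h (γ.cast hx hy) = h γ := by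
      rintro x y _ _ γ rfl rfl
      rfl
    have h0 : p 0 = 0 := projIcc_left _
    have h1 : p 1 = 1 := projIcc_right _
    rw [hA.increment_eq, h0, h1, Path.subpath_self, hrefl, inv_one, one_mul,
      Path.subpath_zero_one, hcast, ← hrefl x, heq] at hγ
    exact hγ

/-- The path `γ` need not be rectifiable. If all rectifiable loops were trivial, `geodesicCocycle`
would be a cocycle at a scale above the diameter, and `t ↦ geodesicCocycle e x (γ t)` would be a
primitive with equal end values. -/
theorem exists_not_shortLoopsTrivial {X G : Type*} [MetricSpace X] [CompactSpace X] [Group G]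
    {r : ℝ} {e : X → X → G} (hX : IsGeodesicSpace X) (he : IsLocalCocycle r e) (hr : 0 < r)
    {x : X} {γ : Path x x} (hγ : increment e γ.extend 0 1 ≠ 1) :
    ∃ ℓ, ¬ ShortLoopsTrivial e ℓ := by
  by_contra! hall
  have hg := hX.isLocalCocycle_geodesicCocycle he hr (hall (3 * (Metric.diam (univ : Set X) + 1)))
  have hdist : ∀ x y : X, dist x y < Metric.diam (univ : Set X) + 1 := fun x y =>
    (Metric.dist_le_diam_of_mem isCompact_univ.isBounded (mem_univ x) (mem_univ y)).trans_lt
      (lt_add_one _)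
  have hA : IsPrimitive e γ.extend fun t => hX.geodesicCocycle e x (γ.extend t) := by
    have huc : UniformContinuous γ.extend :=
      (CompactSpace.uniformContinuous_of_continuous γ.continuous).comp
        (LipschitzWith.projIcc (zero_le_one (α := ℝ))).uniformContinuous
    obtain ⟨η, hη, hd⟩ := Metric.uniformContinuous_iff.1 huc r hr
    refine ⟨η / 2, half_pos hη, fun s t hst => ?_⟩
    have hlt : dist (γ.extend s) (γ.extend t) < r := hd (by rw [Real.dist_eq]; linarith)
    rw [← hX.geodesicCocycle_eq he hr hlt, hg _ _ _ (hdist _ _) (hdist _ _) (hdist _ _)]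
  apply hγ
  rw [hA.increment_eq, Path.extend_zero, Path.extend_one, inv_mul_cancel]

theorem IsClosedGeodesic.lipschitzWith {X : Type*} [MetricSpace X] {L : ℝ}
    {c : C(AddCircle L, X)} (hc : IsClosedGeodesic L c) :
    LipschitzWith 1 fun t : ℝ => c (t : AddCircle L) := by
  obtain ⟨hL, r, hr, h⟩ := hc
  set f := fun t : ℝ => c (t : AddCircle L)
  have hloc : ∀ s t, |s - t| < r → dist (f s) (f t) ≤ |s - t| := by
    intro s t hst
    have h1 := (lipschitzWith_coe_addCircle L).dist_le_mul s t
    rw [NNReal.coe_one, one_mul, Real.dist_eq] at h1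
    exact (h _ _ (h1.trans_lt hst)).trans_le h1
  refine LipschitzWith.of_dist_le_mul fun s t => ?_
  rw [NNReal.coe_one, one_mul, Real.dist_eq]
  obtain ⟨n, hn⟩ := exists_nat_gt (|s - t| / r)
  have hn0 : (0 : ℝ) < n := lt_of_le_of_lt (by positivity) hn
  have hstep : |s - t| / n < r := by rwa [div_lt_comm₀ hn0 hr]
  have := dist_le_range_sum_of_dist_le (f := fun i : ℕ => f (s + i * ((t - s) / n)))
    (d := fun _ => |s - t| / n) n fun {i} _ => by
      have : |s + i * ((t - s) / n) - (s + (i + 1 : ℕ) * ((t - s) / n))| = |s - t| / n := by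
        rw [← abs_of_pos hn0, ← abs_div, abs_of_pos hn0]
        congr 1
        push_cast
        ring
      rw [← this]
      exact hloc _ _ (by rwa [this])
  simpa [mul_div_cancel₀, hn0.ne'] using this

/-- A map from the circle that is null-homotopic as a based loop is null-homotopic. -/
theorem nullhomotopic_of_path_homotopic {X : Type*} [TopologicalSpace X] {L : ℝ} (hL : 0 < L)
    {c : C(AddCircle L, X)} {x : X} {γ : Path x x}
    (hγ : ∀ t : unitInterval, γ t = c ((L * t : ℝ) : AddCircle L))
    (h : γ.Homotopic (Path.refl x)) : c.Nullhomotopic := by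
  have : Fact (0 < L) := ⟨hL⟩
  obtain ⟨H⟩ := h
  let q : C(unitInterval × unitInterval, unitInterval × AddCircle L) :=
    ⟨fun p => (p.1, ((L * p.2 : ℝ) : AddCircle L)), by
      refine continuous_fst.prodMk ((AddCircle.continuous_mk' L).comp ?_)
      fun_prop⟩
  have hsurj : Function.Surjective q := by
    rintro ⟨τ, p⟩
    obtain ⟨s, hs, rfl⟩ : p ∈ (fun t : ℝ => (t : AddCircle L)) '' Ico 0 (0 + L) :=
      AddCircle.coe_image_Ico_eq L 0 ▸ mem_univ p
    rw [zero_add] at hs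
    refine ⟨(τ, ⟨s / L, div_nonneg hs.1 hL.le, (div_le_one hL).2 hs.2.le⟩), ?_⟩
    simp [q, mul_div_cancel₀, hL.ne']
  have hq : IsQuotientMap q := q.continuous.isClosedMap.isQuotientMap q.continuous hsurj
  -- Only the times `0` and `1` are identified by `q`, and the homotopy keeps both at `x`.
  have hfac : Function.FactorsThrough (H : C(unitInterval × unitInterval, X)) q := by
    have key : ∀ (τ s t : unitInterval), (s : ℝ) ≤ t →
        ((L * s : ℝ) : AddCircle L) = ((L * t : ℝ) : AddCircle L) → H (τ, s) = H (τ, t) := by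
      intro τ s t hst heq
      rcases hst.eq_or_lt with h | h
      · rw [Subtype.ext h]
      · by_cases h1 : (t : ℝ) = 1 ∧ (s : ℝ) = 0
        · have ht : t = 1 := Subtype.ext h1.1
          have hs : s = 0 := Subtype.ext h1.2
          rw [ht, hs, H.source, H.target]
        · exfalso
          have hlt : (t : ℝ) - s < 1 := by
            by_contra! hge
            exact h1 ⟨by linarith [t.2.2, s.2.1], by linarith [t.2.2, s.2.1]⟩
          have h2 : ‖((L * t - L * s : ℝ) : AddCircle L)‖ = 0 := by
            rw [AddCircle.coe_sub, heq, sub_self, norm_zero]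
          rw [norm_coe_addCircle (by nlinarith) (by nlinarith) hL] at h2
          have h3 : 0 < min (L * t - L * s) (L - (L * t - L * s)) :=
            lt_min (by nlinarith) (by nlinarith)
          exact h3.ne' h2
    rintro ⟨τ, s⟩ ⟨τ', t⟩ heq
    obtain ⟨rfl, heq'⟩ : τ = τ' ∧ ((L * s : ℝ) : AddCircle L) = ((L * t : ℝ) : AddCircle L) := by
      exact Prod.mk.inj heq
    rcases le_total (s : ℝ) t with h | h
    · exact key τ s t h heq'
    · exact (key τ t s h heq'.symm).symm
  have hlift : ∀ τ t : unitInterval,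
      hq.lift (H : C(unitInterval × unitInterval, X)) hfac (τ, ((L * t : ℝ) : AddCircle L)) =
      H (τ, t) := fun τ t =>
    DFunLike.congr_fun (hq.lift_comp (H : C(unitInterval × unitInterval, X)) hfac) (τ, t)
  refine ⟨x, ⟨⟨hq.lift (H : C(unitInterval × unitInterval, X)) hfac, fun p => ?_, fun p => ?_⟩⟩⟩
  · obtain ⟨⟨τ, t⟩, hp⟩ := hsurj (0, p)
    obtain ⟨-, rfl⟩ : τ = 0 ∧ ((L * t : ℝ) : AddCircle L) = p := by simpa [q] using hp
    exact (hlift 0 t).trans ((H.apply_zero t).trans (hγ t))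
  · obtain ⟨⟨τ, t⟩, hp⟩ := hsurj (1, p)
    obtain ⟨-, rfl⟩ : τ = 1 ∧ ((L * t : ℝ) : AddCircle L) = p := by simpa [q] using hp
    exact (hlift 1 t).trans (H.apply_one t)

/-- A closed geodesic shorter than `L` is a `1`-Lipschitz loop with trivial increment, hence
null-homotopic by `hnull`. -/
theorem le_of_mem_nonNullGeodesicLengths {X G : Type*} [MetricSpace X] [Group G]
    {r : ℝ} {e : X → X → G} (he : IsLocalCocycle r e) (hr : 0 < r)
    (hnull : ∀ (x : X) (γ : Path x x), increment e γ.extend 0 1 = 1 → γ.Homotopic (Path.refl x))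
    {L : ℝ} (hL : ShortLoopsTrivial e L) {ℓ : ℝ} (hℓ : ℓ ∈ nonNullGeodesicLengths X) : L ≤ ℓ := by
  obtain ⟨c, hc, hcn⟩ := hℓ
  by_contra! hlt
  have hℓ0 := hc.1
  set f := fun t : ℝ => c (t : AddCircle ℓ)
  have hf : LipschitzWith 1 f := hc.lipschitzWith
  have hf0 : f 0 = f ℓ := by simp [f, AddCircle.coe_period]
  have hinc := hL f hf 0 ℓ hℓ0.le (by linarith) hf0
  let φ : ℝ → ℝ := fun t => ℓ * (projIcc (0 : ℝ) 1 zero_le_one t : ℝ)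
  have hφ : LipschitzWith ℓ.toNNReal φ := LipschitzWith.of_dist_le_mul fun s t => by
    have := (LipschitzWith.projIcc (zero_le_one (α := ℝ))).dist_le_mul s t
    rw [NNReal.coe_one, one_mul, Subtype.dist_eq, Real.dist_eq] at this
    rw [Real.coe_toNNReal _ hℓ0.le, Real.dist_eq, ← mul_sub, abs_mul, abs_of_pos hℓ0]
    gcongr
  let γ : Path (f 0) (f 0) :=
    { toFun := fun t => f (ℓ * t)
      continuous_toFun := hf.continuous.comp (by fun_prop)
      source' := by simp
      target' := by simp [hf0] }
  have hγ : increment e γ.extend 0 1 = 1 := by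
    have : γ.extend = f ∘ φ := rfl
    rw [this, increment_comp he hr hf.uniformContinuous hφ]
    simpa [φ] using hinc
  exact hcn (nullhomotopic_of_path_homotopic hℓ0 (fun _ => rfl) (hnull _ γ hγ))

end Semilocal

/-! ### The critical loop on a shortest circle -/

section Hexagon

variable {X G : Type*} [MetricSpace X] [Group G] {r L : ℝ} {e : X → X → G} {f : ℝ → X}

/-- Six equidistant points on a loop of length `L`. -/
noncomputable def hexagon (f : ℝ → X) (L : ℝ) : List X :=
  -- Three points would have spacing `L / 3` on an isometric circle and so give no `L / 3`-chain;
  -- the midpoints make the inequality strict.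
  [f 0, f (L / 6), f (2 * L / 6), f (3 * L / 6), f (4 * L / 6), f (5 * L / 6), f L]

theorem isEpsChain_hexagon (hL : 0 < L) (hf : LipschitzWith 1 f) {δ : ℝ} (hδ : L / 3 ≤ δ) :
    IsEpsChain δ (hexagon f L) := by
  have hd : ∀ s t, s ≤ t → t - s < δ → dist (f s) (f t) < δ := fun s t hst h => by
    have := hf.dist_le_mul s t
    rw [NNReal.coe_one, one_mul, Real.dist_eq, abs_sub_comm, abs_of_nonneg (by linarith)] at this
    linarith
  refine ⟨by simp [hexagon], ?_⟩
  simp only [hexagon, List.isChain_cons_cons, List.isChain_singleton, and_true]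
  refine ⟨?_, ?_, ?_, ?_, ?_, ?_⟩ <;> apply hd <;> linarith

theorem isEpsNull_hexagon (hL : 0 < L) (hf : LipschitzWith 1 f) (hf0 : f 0 = f L) {δ : ℝ}
    (hδ : L / 3 < δ) : IsEpsNull δ (f 0) (hexagon f L) := by
  have hd : ∀ s t, s ≤ t → t - s < δ → dist (f s) (f t) < δ := fun s t hst h => by
    have := hf.dist_le_mul s t
    rw [NNReal.coe_one, one_mul, Real.dist_eq, abs_sub_comm, abs_of_nonneg (by linarith)] at this
    linarith
  have h02 : dist (f 0) (f (2 * L / 6)) < δ := hd _ _ (by linarith) (by linarith)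
  have h24 : dist (f (2 * L / 6)) (f (4 * L / 6)) < δ := hd _ _ (by linarith) (by linarith)
  have h46 : dist (f (4 * L / 6)) (f L) < δ := hd _ _ (by linarith) (by linarith)
  have h04 : dist (f 0) (f (4 * L / 6)) < δ := by rwa [hf0, dist_comm]
  have h06 : dist (f 0) (f L) < δ := by rw [hf0, dist_self]; linarith
  have hc := isEpsChain_hexagon hL hf hδ.le
  have hc' := hc.2
  simp only [hexagon, List.isChain_cons_cons, List.isChain_singleton, and_true] at hc'
  have chain : ∀ {l : List X}, l ≠ [] → l.IsChain (fun x y => dist x y < δ) → IsEpsChain δ l :=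
    fun h1 h2 => ⟨h1, h2⟩
  -- Above `L / 3` the three intermediate points can be dropped; the remaining triangle has sides `<
  -- δ` and collapses.
  have m1 := basicMove_remove_second hc h02
  have m2 := (basicMove_remove_second (chain (by simp) (by simp [hc']) :
    IsEpsChain δ [f (2 * L / 6), f (3 * L / 6), f (4 * L / 6), f (5 * L / 6), f L]) h24).cons
      rfl h02
  have m3 := ((basicMove_remove_second (chain (by simp) (by simp [hc']) :
    IsEpsChain δ [f (4 * L / 6), f (5 * L / 6), f L]) h46).cons rfl h24).cons rfl h02
  have m4 := basicMove_remove_second m3.2.1 h04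
  have m5 := basicMove_remove_second m4.2.1 h06
  have m6 : BasicMove δ [f 0, f L] [f 0] := by
    have := m5.2.1
    rw [← hf0] at this ⊢
    exact basicMove_remove_first this
  exact ⟨hc, m6.2.1, (((((Relation.ReflTransGen.single m1).tail m2).tail m3).tail m4).tail
    m5).tail m6⟩

/-- Each arc and its chord have total length at most `L / 3 < L`, so their increments agree. -/
theorem chainProd_hexagon (hX : IsGeodesicSpace X) (he : IsLocalCocycle r e) (hr : 0 < r)
    (hL : 0 < L) (hs : ShortLoopsTrivial e L) (hf : LipschitzWith 1 f) :
    chainProd (hX.geodesicCocycle e) (hexagon f L) = increment e f 0 L := by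
  have key : ∀ s t, s ≤ t → t - s ≤ L / 6 →
      hX.geodesicCocycle e (f s) (f t) = increment e f s t := by
    intro s t hst h
    have := hf.dist_le_mul s t
    rw [NNReal.coe_one, one_mul, Real.dist_eq, abs_sub_comm, abs_of_nonneg (by linarith)] at this
    exact hs.increment_eq he hr (hX.lipschitzWith_geodesic _ _) hf dist_nonneg hst
      (by linarith) (by simp) (by simp)
  simp only [hexagon, chainProd_cons_cons, chainProd_singleton, mul_one]
  repeat rw [key _ _ (by linarith) (by linarith)]
  simp only [increment_mul he hr hf.uniformContinuous]

theorem isEpsCritical_hexagon (hX : IsGeodesicSpace X) (he : IsLocalCocycle r e) (hr : 0 < r)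
    (hL : 0 < L) (hs : ShortLoopsTrivial e L) (hf : LipschitzWith 1 f) (hf0 : f 0 = f L)
    (hinc : increment e f 0 L ≠ 1) : IsEpsCritical (L / 3) (f 0) (hexagon f L) := by
  refine ⟨⟨isEpsChain_hexagon hL hf le_rfl, rfl, by simp [hexagon, hf0]⟩, fun hnull => hinc ?_,
    fun δ hδ => isEpsNull_hexagon hL hf hf0 hδ⟩
  -- Both inequalities are strict: triangles with sides `< L / 3` have perimeter `< L`, so the
  -- extremal scale itself is allowed.
  have hg : IsLocalCocycle (L / 3) (hX.geodesicCocycle e) :=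
    hX.isLocalCocycle_geodesicCocycle he hr (by rwa [mul_div_cancel₀ L three_ne_zero])
  rw [← chainProd_hexagon hX he hr hL hs hf]
  exact hg.chainProd_eq_one (by positivity) hnull

end Hexagon

/-! ### The shortest circle realises the systole and the critical value -/

theorem exists_shortest_nonNull_circle {X : Type*} [MetricSpace X] [CompactSpace X] [Nonempty X]
    (hX : IsGeodesicSpace X) (hs : SemilocallySimplyConnected X) (hn : ¬ SimplyConnectedSpace X) :
    ∃ L, 0 < L ∧ oneSystole X = ENNReal.ofReal L ∧ L / 3 ∈ homotopyCriticalSpectrum X := by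
  obtain ⟨G, _, e, r, hr, he, hnull⟩ := hs.exists_isLocalCocycle hX
  have := hX.pathConnectedSpace
  rw [simply_connected_iff_loops_nullhomotopic] at hn
  push Not at hn
  obtain ⟨x, γ, hγ⟩ := hn this
  obtain ⟨ℓ, hℓ⟩ := exists_not_shortLoopsTrivial hX he hr fun h => hγ (hnull x γ h)
  obtain ⟨L, hL, -, hshort, c, hc, hinc⟩ := exists_shortest_closedGeodesic hX he hr hℓ
  refine ⟨L, hL, le_antisymm
    (iInf₂_le L (mem_nonNullGeodesicLengths_of_isometry he hr hL hc hinc))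
    (le_iInf₂ fun ℓ' hℓ' => ENNReal.ofReal_le_ofReal
      (le_of_mem_nonNullGeodesicLengths he hr hnull hshort hℓ')), by positivity, _, _,
    isEpsCritical_hexagon hX he hr hL hshort (isClosedGeodesic_of_isometry hL hc).lipschitzWith
      (by simp [AddCircle.coe_period]) hinc⟩

end DiscreteHomotopy

theorem corollary3 {X : Type*} [MetricSpace X] [CompactSpace X] [Nonempty X]
    (hX : DiscreteHomotopy.IsGeodesicSpace X) :
    (∀ ε ∈ DiscreteHomotopy.homotopyCriticalSpectrum X,
      DiscreteHomotopy.oneSystole X / 3 ≤ ENNReal.ofReal ε) ∧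
    (DiscreteHomotopy.SemilocallySimplyConnected X → ¬ SimplyConnectedSpace X →
      0 < DiscreteHomotopy.oneSystole X ∧ DiscreteHomotopy.oneSystole X ≠ ⊤ ∧
      IsLeast (DiscreteHomotopy.homotopyCriticalSpectrum X)
        ((DiscreteHomotopy.oneSystole X).toReal / 3)) := by
  refine ⟨fun ε hε => DiscreteHomotopy.oneSystole_div_three_le hX hε, fun hs hn => ?_⟩
  obtain ⟨L, hL, hsys, hmem⟩ := DiscreteHomotopy.exists_shortest_nonNull_circle hX hs hn
  have hle := fun ε hε => DiscreteHomotopy.oneSystole_div_three_le hX (ε := ε) hε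
  rw [hsys] at hle ⊢
  refine ⟨ENNReal.ofReal_pos.2 hL, ENNReal.ofReal_ne_top, ?_⟩
  rw [ENNReal.toReal_ofReal hL.le]
  refine ⟨hmem, fun ε hε => ?_⟩
  have h := hle ε hε
  rw [← ENNReal.ofReal_ofNat, ← ENNReal.ofReal_div_of_pos (by norm_num)] at h
  exact (ENNReal.ofReal_le_ofReal_iff hε.1.le).1 h
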